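/- **Conventions.** Let $A$ be a commutative ring with $1$. $W(A)=1+T A[[T]]$ denotes the ring of big Witt vectors: its addition is the multiplication of power series, and its multiplication is the unique biadditive, functorial and $T$-adically continuous operation with $(1-aT)\cdot(1-bT)=1-abT$; its unit is $1-T$. The subring $W_{\mathrm{rat}}(A)\subset W(A)$ of rational Witt vectors consists of all $f=P/Q$ with $P,Q\in A[T]$, $P(0)=Q(0)=1$. For $f=1+a_1T+a_2T^2+\cdots\in W(A)$ let $H(f)=(a_{i+j})_{i,j\ge 0}$, $a_0=1$, be its Hankel matrix, and let $W_J(A)\subset W(A)$ be the set of all $f$ for which there is an integer $r\ge 1$ such that all $(r+1)\times(r+1)$ minors of $H(f)$ vanish. An integral domain $A$ with quotient field $K$ is a *strong Fatou domain* if for every $f\in K(T)\cap A[[T]]$ the unique representation $f=P/Q$ with coprime $P,Q\in K[T]$ and $Q(0)=1$ satisfies $P,Q\in A[T]$. An integral scheme $X$ is *strong Fatou* if for every nonempty affine open $U\subset X$ the ring $\mathcal O(U)$ is a strong Fatou domain. **Theorem.** Let $X$ be a strong Fatou scheme. Then the presheaf of rings $U\mapsto W_{\mathrm{rat}}(\mathcal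 O(U))$ on the topological space $X$ is a sheaf (for the Zariski topology). Moreover, for every open $U\subset X$ we have $W_{\mathrm{rat}}(\mathcal O(U))=W_J(\mathcal O(U))$ inside $W(\mathcal O(U))$; in particular $W_J(\mathcal O(U))$ is a subring of $W(\mathcal O(U))$ and the equality is one of rings. -/

import Mathlib

open CategoryTheory
open scoped AlgebraicGeometry
open scoped PowerSeries Polynomial Kronecker

/-! ## Reversed characteristic polynomials and power sums -/

namespace BigWitt

section Det

variable {R : Type*} [CommRing R] {n : Type*} [Fintype n] [DecidableEq n]

theorem derivative_prod {ι : Type*} [DecidableEq ι] (s : Finset ι) (f : ι → R⟦X⟧) :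
    PowerSeries.derivative R (∏ i ∈ s, f i) =
      ∑ i ∈ s, (∏ j ∈ s.erase i, f j) * PowerSeries.derivative R (f i) := by
  induction s using Finset.induction_on with
  | empty => simp
  | insert a s ha ih =>
    rw [Finset.prod_insert ha, Derivation.leibniz, ih, Finset.sum_insert ha,
      Finset.erase_insert ha, smul_eq_mul, smul_eq_mul, add_comm, Finset.mul_sum]
    congr 1
    refine Finset.sum_congr rfl fun i hi => ?_
    have hai : a ≠ i := fun h => ha (h ▸ hi)
    rw [Finset.erase_insert_of_ne hai, Finset.prod_insert (by simp [ha]), mul_assoc]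

theorem derivative_det (A : Matrix n n R⟦X⟧) :
    PowerSeries.derivative R A.det =
      (A.adjugate * A.map (PowerSeries.derivative R)).trace := by
  have h1 : ∀ i, (A.adjugate * A.map (PowerSeries.derivative R)) i i =
      (A.updateCol i (fun k => PowerSeries.derivative R (A k i))).det := by
    intro i
    rw [← Matrix.cramer_apply, Matrix.cramer_eq_adjugate_mulVec]
    rfl
  simp only [Matrix.trace, Matrix.diag_apply, h1, Matrix.det_apply', map_sum]
  rw [Finset.sum_comm]
  refine Finset.sum_congr rfl fun σ _ => ?_
  rw [Derivation.leibniz, derivative_prod]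
  have h0 : PowerSeries.derivative R (((Equiv.Perm.sign σ : ℤˣ) : ℤ) : R⟦X⟧) = 0 :=
    Derivation.map_intCast _ _
  rw [h0, smul_zero, add_zero, smul_eq_mul, Finset.mul_sum]
  refine Finset.sum_congr rfl fun i _ => ?_
  congr 1
  rw [← Finset.mul_prod_erase Finset.univ _ (Finset.mem_univ i), mul_comm]
  congr 1
  · simp
  · refine Finset.prod_congr rfl fun j hj => ?_
    rw [Matrix.updateCol_ne (Finset.ne_of_mem_erase hj)]

/-- The power series `∑_{i ≥ 1} tr(Mⁱ) Tⁱ`. -/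
noncomputable def traceSeries (M : Matrix n n R) : R⟦X⟧ :=
  PowerSeries.mk fun i => if i = 0 then 0 else (M ^ i).trace

theorem charpolyRev_mul_traceSeries (M : Matrix n n R) :
    (M.charpolyRev : R⟦X⟧) * traceSeries M =
      -(PowerSeries.X * PowerSeries.derivative R (M.charpolyRev : R⟦X⟧)) := by
  set A : Matrix n n R⟦X⟧ :=
    1 - (PowerSeries.X : R⟦X⟧) • M.map (PowerSeries.C (R := R)) with hA
  have hdet : (M.charpolyRev : R⟦X⟧) = A.det := by
    rw [Matrix.charpolyRev, ← Polynomial.coeToPowerSeries.ringHom_apply, RingHom.map_det]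
    congr 1
    ext i j : 1
    simp only [RingHom.mapMatrix_apply, Matrix.map_apply, Matrix.sub_apply, Matrix.smul_apply,
      map_sub, hA, smul_eq_mul, map_mul, Polynomial.coeToPowerSeries.ringHom_apply,
      Polynomial.coe_X, Polynomial.coe_C]
    congr 1
    by_cases h : i = j <;> simp [Matrix.one_apply, h]
  set S : Matrix n n R⟦X⟧ := fun a b => PowerSeries.mk fun i => (M ^ i) a b with hS
  have hXMS : ∀ a b k, PowerSeries.coeff k
      (((PowerSeries.X : R⟦X⟧) • M.map (PowerSeries.C (R := R)) * S) a b) =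
        if k = 0 then 0 else (M ^ k) a b := by
    intro a b k
    rw [Matrix.smul_mul, Matrix.smul_apply, smul_eq_mul]
    cases k with
    | zero => simp
    | succ k =>
      rw [PowerSeries.coeff_succ_X_mul, Matrix.mul_apply, map_sum, if_neg (Nat.succ_ne_zero k),
        pow_succ', Matrix.mul_apply]
      refine Finset.sum_congr rfl fun c _ => ?_
      simp [hS, PowerSeries.coeff_C_mul]
  have hAS : A * S = 1 := by
    ext a b k
    rw [hA, sub_mul, one_mul, Matrix.sub_apply, map_sub, hXMS]
    cases k with
    | zero => by_cases h : a = b <;> simp [hS, Matrix.one_apply, h]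
    | succ k => by_cases h : a = b <;> simp [hS, Matrix.one_apply, h, PowerSeries.coeff_one]
  have hadj : A.adjugate = A.det • S := by
    calc A.adjugate = A.adjugate * (A * S) := by rw [hAS, mul_one]
      _ = (A.adjugate * A) * S := by rw [mul_assoc]
      _ = A.det • S := by rw [Matrix.adjugate_mul, Matrix.smul_mul, one_mul]
  have hD : A.map (PowerSeries.derivative R) = -M.map (PowerSeries.C (R := R)) := by
    ext i j : 1
    have h0 : PowerSeries.derivative R ((1 : Matrix n n R⟦X⟧) i j) = 0 := by
      by_cases h : i = j <;> simp [Matrix.one_apply, h]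
    rw [Matrix.map_apply, hA, Matrix.sub_apply, map_sub, h0]
    simp [Derivation.leibniz]
  have htr : PowerSeries.X * (S * M.map (PowerSeries.C (R := R))).trace = traceSeries M := by
    ext k
    rw [Matrix.trace_mul_comm, ← smul_eq_mul, ← Matrix.trace_smul, ← Matrix.smul_mul,
      Matrix.trace, map_sum]
    simp only [Matrix.diag_apply, hXMS, traceSeries, PowerSeries.coeff_mk]
    split_ifs <;> simp [Matrix.trace]
  rw [hdet, derivative_det, hD, hadj, Matrix.mul_neg, Matrix.trace_neg, Matrix.smul_mul,
    Matrix.trace_smul, ← htr, smul_eq_mul]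
  ring

theorem map_charpolyRev {S : Type*} [CommRing S] (φ : R →+* S) (M : Matrix n n R) :
    (M.map φ).charpolyRev = M.charpolyRev.map φ := by
  rw [Matrix.charpolyRev, Matrix.charpolyRev, ← Polynomial.coe_mapRingHom, RingHom.map_det]
  congr 1
  ext i j : 1
  by_cases h : i = j <;> simp [h]

end Det

/-! ## The underlying set of the ring of big Witt vectors -/

/-- The companion matrix `C` of size `n` with `det (1 - T C) = 1 + a₁ T + ⋯ + aₙ Tⁿ`, where `aᵢ`
is the `i`-th coefficient of `f`. -/
noncomputable def companion {A : Type*} [CommRing A] (n : ℕ) (f : A⟦X⟧) : Matrix (Fin n) (Fin n) A :=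
  fun i j => if (i : ℕ) = 0 then -PowerSeries.coeff ((j : ℕ) + 1) f
    else if (i : ℕ) = (j : ℕ) + 1 then 1 else 0

theorem map_companion {A B : Type*} [CommRing A] [CommRing B] (φ : A →+* B) (n : ℕ) (f : A⟦X⟧) :
    (companion n f).map φ = companion n (PowerSeries.map φ f) := by
  ext i j
  simp only [Matrix.map_apply, companion]
  split_ifs <;> simp

theorem charpolyRev_companion {A : Type*} [CommRing A] (n : ℕ) (f : A⟦X⟧) :
    (companion n f).charpolyRev =
      1 + ∑ i : Fin n, Polynomial.C (PowerSeries.coeff ((i : ℕ) + 1) f) *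
        Polynomial.X ^ ((i : ℕ) + 1) := by
  set N : Matrix (Fin n) (Fin n) A[X] :=
    fun i j => (if i = j then 1 else 0) - (if (i : ℕ) = (j : ℕ) + 1 then Polynomial.X else 0)
    with hN
  set w : Fin n → A[X] := fun i => Polynomial.X ^ ((i : ℕ) + 1) with hw
  set v : Fin n → A[X] := fun j => Polynomial.C (PowerSeries.coeff ((j : ℕ) + 1) f) with hv
  have hNw : ∀ i : Fin n, (N.mulVec w) i = if (i : ℕ) = 0 then Polynomial.X else 0 := by
    intro i
    have h1 : (N.mulVec w) i = w i - ∑ j : Fin n,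
        (if (i : ℕ) = (j : ℕ) + 1 then Polynomial.X else 0) * w j := by
      simp [Matrix.mulVec, dotProduct, hN, sub_mul, Finset.sum_sub_distrib]
    rw [h1]
    by_cases hi : (i : ℕ) = 0
    · rw [Finset.sum_eq_zero, if_pos hi, hw]
      · simp [hi]
      · intro j _
        rw [if_neg (by omega), zero_mul]
    · have hi' : (i : ℕ) - 1 < n := by omega
      rw [Finset.sum_eq_single (⟨(i : ℕ) - 1, hi'⟩ : Fin n), if_neg hi]
      · rw [if_pos (by simp only; omega), hw]
        simp only
        rw [show (i : ℕ) - 1 + 1 = (i : ℕ) by omega, ← pow_succ', sub_self]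
      · intro j _ hj
        rw [if_neg, zero_mul]
        intro h
        apply hj
        ext
        simp only
        omega
      · intro h
        exact absurd (Finset.mem_univ _) h
  have hfac : (1 : Matrix (Fin n) (Fin n) A[X]) -
      (Polynomial.X : A[X]) • (companion n f).map Polynomial.C =
        N * (1 + Matrix.replicateCol Unit w * Matrix.replicateRow Unit v) := by
    have h2 : N * (1 + Matrix.replicateCol Unit w * Matrix.replicateRow Unit v) =
        N + Matrix.of fun i j => (N.mulVec w) i * v j := by
      rw [mul_add, mul_one, ← Matrix.mul_assoc]
      congr 1
      ext i j : 1
      simp [Matrix.mul_apply, Matrix.mulVec, dotProduct]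
    rw [h2]
    ext i j : 1
    rw [Matrix.add_apply, Matrix.of_apply, hNw]
    simp only [Matrix.sub_apply, Matrix.one_apply, Matrix.smul_apply, Matrix.map_apply, companion,
      hN, hv, smul_eq_mul]
    by_cases hi : (i : ℕ) = 0
    · rw [if_pos hi, if_pos hi, if_neg (show ¬ (i : ℕ) = (j : ℕ) + 1 by omega)]
      simp
    · rw [if_neg hi, if_neg hi]
      split_ifs <;> simp
  have hdN : N.det = 1 := by
    rw [Matrix.det_of_isLowerTriangular N]
    · refine Finset.prod_eq_one fun i _ => ?_
      simp [hN]
    · intro i j hij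
      have hij' : i < j := hij
      have h3 : (i : ℕ) < (j : ℕ) := hij'
      simp only [hN]
      rw [if_neg (ne_of_lt hij'), if_neg (by omega), sub_zero]
  rw [Matrix.charpolyRev, hfac, Matrix.det_mul, hdN, one_mul,
    Matrix.det_one_add_replicateCol_mul_replicateRow]
  simp [dotProduct, hw, hv]

theorem coeff_charpolyRev_companion {A : Type*} [CommRing A] (n : ℕ) (f : A⟦X⟧)
    (hf : PowerSeries.constantCoeff f = 1) (k : ℕ) :
    (companion n f).charpolyRev.coeff k = if k ≤ n then PowerSeries.coeff k f else 0 := by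
  rw [charpolyRev_companion, Polynomial.coeff_add, Polynomial.finsetSum_coeff]
  simp only [Polynomial.coeff_C_mul_X_pow]
  cases k with
  | zero => simp [hf]
  | succ k =>
    rw [Polynomial.coeff_one, if_neg (Nat.succ_ne_zero k), zero_add]
    by_cases hk : k < n
    · rw [if_pos (by omega), Finset.sum_eq_single (⟨k, hk⟩ : Fin n)]
      · simp
      · intro j _ hj
        rw [if_neg]
        intro h
        apply hj
        ext
        simp only
        omega
      · intro h
        exact absurd (Finset.mem_univ _) h
    · rw [if_neg (by omega)]
      refine Finset.sum_eq_zero fun j _ => ?_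
      rw [if_neg]
      have := j.2
      omega

theorem coeff_eq_of_powerSum {A : Type*} [CommRing A] [IsAddTorsionFree A] {f g s t : A⟦X⟧}
    (hf : PowerSeries.constantCoeff f = 1) (hg : PowerSeries.constantCoeff g = 1)
    (hfs : f * s = -(PowerSeries.X * PowerSeries.derivative A f))
    (hgt : g * t = -(PowerSeries.X * PowerSeries.derivative A g)) (k : ℕ)
    (h : ∀ i ≤ k, PowerSeries.coeff i s = PowerSeries.coeff i t) :
    ∀ i ≤ k, PowerSeries.coeff i f = PowerSeries.coeff i g := by
  intro i
  induction i using Nat.strong_induction_on with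
  | _ i ih =>
    intro hik
    cases i with
    | zero => rw [PowerSeries.coeff_zero_eq_constantCoeff_apply, hf,
        PowerSeries.coeff_zero_eq_constantCoeff_apply, hg]
    | succ i =>
      have hs0 : PowerSeries.coeff 0 s = 0 := by
        have := congrArg PowerSeries.constantCoeff hfs
        simpa [hf] using this
      have ht0 : PowerSeries.coeff 0 t = 0 := by rw [← h 0 (Nat.zero_le k), hs0]
      have e1 := congrArg (PowerSeries.coeff (i + 1)) hfs
      have e2 := congrArg (PowerSeries.coeff (i + 1)) hgt
      rw [map_neg, PowerSeries.coeff_succ_X_mul, PowerSeries.coeff_derivative,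
        PowerSeries.coeff_mul] at e1 e2
      have e3 : ∑ p ∈ Finset.HasAntidiagonal.antidiagonal (i + 1), PowerSeries.coeff p.1 f * PowerSeries.coeff p.2 s
          = ∑ p ∈ Finset.HasAntidiagonal.antidiagonal (i + 1),
            PowerSeries.coeff p.1 g * PowerSeries.coeff p.2 t := by
        refine Finset.sum_congr rfl fun p hp => ?_
        have hp' := Finset.HasAntidiagonal.mem_antidiagonal.mp hp
        by_cases h2 : p.2 = 0
        · rw [h2, hs0, ht0, mul_zero, mul_zero]
        · rw [ih p.1 (by omega) (by omega), h p.2 (by omega)]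
      rw [e3, e2, neg_inj] at e1
      have e4 : (i + 1) • PowerSeries.coeff (i + 1) f = (i + 1) • PowerSeries.coeff (i + 1) g := by
        rw [nsmul_eq_mul, nsmul_eq_mul, mul_comm, mul_comm ((i + 1 : ℕ) : A)]
        push_cast
        exact e1.symm
      exact nsmul_right_injective (Nat.succ_ne_zero i) e4

theorem powerSum_eq_of_coeff {A : Type*} [CommRing A] {f g s t : A⟦X⟧}
    (hf : PowerSeries.constantCoeff f = 1) (hg : PowerSeries.constantCoeff g = 1)
    (hfs : f * s = -(PowerSeries.X * PowerSeries.derivative A f))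
    (hgt : g * t = -(PowerSeries.X * PowerSeries.derivative A g)) (k : ℕ)
    (h : ∀ i ≤ k, PowerSeries.coeff i f = PowerSeries.coeff i g) :
    ∀ i ≤ k, PowerSeries.coeff i s = PowerSeries.coeff i t := by
  intro i
  induction i using Nat.strong_induction_on with
  | _ i ih =>
    intro hik
    have e1 := congrArg (PowerSeries.coeff i) hfs
    have e2 := congrArg (PowerSeries.coeff i) hgt
    have e0 : PowerSeries.coeff i (-(PowerSeries.X * PowerSeries.derivative A f)) =
        PowerSeries.coeff i (-(PowerSeries.X * PowerSeries.derivative A g)) := by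
      cases i with
      | zero => simp
      | succ i =>
        rw [map_neg, map_neg, PowerSeries.coeff_succ_X_mul, PowerSeries.coeff_succ_X_mul,
          PowerSeries.coeff_derivative, PowerSeries.coeff_derivative, h _ hik]
    rw [e0, ← e2, PowerSeries.coeff_mul, PowerSeries.coeff_mul,
      Finset.Nat.sum_antidiagonal_eq_sum_range_succ_mk,
      Finset.Nat.sum_antidiagonal_eq_sum_range_succ_mk,
      Finset.sum_range_succ', Finset.sum_range_succ'] at e1
    simp only [Nat.sub_zero, PowerSeries.coeff_zero_eq_constantCoeff_apply, hf, hg, one_mul] at e1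
    have e3 : ∑ x ∈ Finset.range i, PowerSeries.coeff (x + 1) f * PowerSeries.coeff (i - (x + 1)) s
        = ∑ x ∈ Finset.range i,
          PowerSeries.coeff (x + 1) g * PowerSeries.coeff (i - (x + 1)) t := by
      refine Finset.sum_congr rfl fun x hx => ?_
      have hx' := Finset.mem_range.mp hx
      rw [h (x + 1) (by omega), ih (i - (x + 1)) (by omega) (by omega)]
    rw [e3] at e1
    exact add_left_cancel e1

end BigWitt

/-- The set `W(A) = 1 + T A⟦T⟧`. -/
@[ext]
structure BigWitt (A : Type*) [CommRing A] where
  /-- The underlying power series. -/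
  series : A⟦X⟧
  constantCoeff_series : PowerSeries.constantCoeff series = 1

namespace BigWitt

section Ops

variable {A : Type*} [CommRing A]

theorem invOfUnit_constantCoeff (f : BigWitt A) :
    PowerSeries.constantCoeff (PowerSeries.invOfUnit f.series 1) = 1 := by
  simp

theorem series_mul_inv (f : BigWitt A) : f.series * PowerSeries.invOfUnit f.series 1 = 1 :=
  PowerSeries.mul_invOfUnit _ _ (by simp [f.constantCoeff_series])

/-- The `n`-th approximation `det (1 - T (C ⊗ D))` to the Witt product of `f` and `g`, where
`det (1 - T C)` and `det (1 - T D)` are the truncations of `f` and `g` in degrees `≤ n`. If these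
truncations are `∏ (1 - aᵢ T)` and `∏ (1 - bⱼ T)`, then it is `∏ (1 - aᵢ bⱼ T)`. -/
noncomputable def approx (n : ℕ) (f g : A⟦X⟧) : A[X] :=
  (companion n f ⊗ₖ companion n g).charpolyRev

theorem approx_constantCoeff (n : ℕ) (f g : A⟦X⟧) :
    PowerSeries.constantCoeff (approx n f g : A⟦X⟧) = 1 := by
  have h := Matrix.eval_charpolyRev (M := companion n f ⊗ₖ companion n g)
  rw [← Polynomial.coeff_zero_eq_eval_zero] at h
  rw [← PowerSeries.coeff_zero_eq_constantCoeff_apply, Polynomial.coeff_coe]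
  exact h

/-- Witt addition is multiplication of power series. -/
noncomputable instance : Add (BigWitt A) :=
  ⟨fun f g => ⟨f.series * g.series, by
    rw [map_mul, f.constantCoeff_series, g.constantCoeff_series, mul_one]⟩⟩

noncomputable instance : Zero (BigWitt A) := ⟨⟨1, by simp⟩⟩

noncomputable instance : Neg (BigWitt A) :=
  ⟨fun f => ⟨PowerSeries.invOfUnit f.series 1, f.invOfUnit_constantCoeff⟩⟩

/-- The unit for the Witt multiplication is `1 - T`. -/
noncomputable instance : One (BigWitt A) := ⟨⟨1 - PowerSeries.X, by simp⟩⟩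

/-- The Witt multiplication: the biadditive, functorial and `T`-adically continuous operation with
`(1 - a T) * (1 - b T) = 1 - a b T`. -/
noncomputable instance : Mul (BigWitt A) :=
  ⟨fun f g => ⟨PowerSeries.mk fun n => (approx n f.series g.series).coeff n, by
    have h := approx_constantCoeff 0 f.series g.series
    rw [← PowerSeries.coeff_zero_eq_constantCoeff_apply] at h ⊢
    rw [Polynomial.coeff_coe] at h
    rw [PowerSeries.coeff_mk, h]⟩⟩

theorem add_series (f g : BigWitt A) : (f + g).series = f.series * g.series := rfl
theorem zero_series : (0 : BigWitt A).series = 1 := rfl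
theorem one_series : (1 : BigWitt A).series = 1 - PowerSeries.X := rfl
theorem neg_series (f : BigWitt A) : (-f).series = PowerSeries.invOfUnit f.series 1 := rfl
theorem coeff_mul_series (f g : BigWitt A) (n : ℕ) :
    PowerSeries.coeff n (f * g).series = (approx n f.series g.series).coeff n :=
  PowerSeries.coeff_mk n fun n => (approx n f.series g.series).coeff n

/-- The logarithmic derivative `-T f' / f`, whose coefficients are the ghost components. -/
noncomputable def ghost (f : BigWitt A) : A⟦X⟧ :=
  -(PowerSeries.X * PowerSeries.derivative A f.series) * PowerSeries.invOfUnit f.series 1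

theorem series_mul_ghost (f : BigWitt A) :
    f.series * f.ghost = -(PowerSeries.X * PowerSeries.derivative A f.series) := by
  rw [ghost, mul_comm, mul_assoc, mul_comm _ f.series, series_mul_inv, mul_one]

theorem ghost_eq_of_mul_eq (f : BigWitt A) (s : A⟦X⟧)
    (h : f.series * s = -(PowerSeries.X * PowerSeries.derivative A f.series)) : f.ghost = s := by
  rw [ghost, ← h, mul_right_comm, series_mul_inv, one_mul]

theorem ghost_add (f g : BigWitt A) : (f + g).ghost = f.ghost + g.ghost := by
  apply ghost_eq_of_mul_eq
  rw [add_series, Derivation.leibniz, smul_eq_mul, smul_eq_mul]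
  linear_combination g.series * f.series_mul_ghost + f.series * g.series_mul_ghost

theorem coeff_ghost_zero (f : BigWitt A) : PowerSeries.coeff 0 f.ghost = 0 := by
  simp [ghost]

theorem coeff_ghost_one (n : ℕ) :
    PowerSeries.coeff n (1 : BigWitt A).ghost = if n = 0 then 0 else 1 := by
  have h : (1 : BigWitt A).ghost = PowerSeries.X * PowerSeries.mk 1 := by
    apply ghost_eq_of_mul_eq
    have h1 : (PowerSeries.mk 1 : A⟦X⟧) * (1 - PowerSeries.X) = 1 :=
      PowerSeries.mk_one_mul_one_sub_eq_one A
    rw [one_series, map_sub, Derivation.map_one_eq_zero, PowerSeries.derivative_X]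
    linear_combination PowerSeries.X * h1
  rw [h]
  cases n with
  | zero => simp
  | succ n => rw [PowerSeries.coeff_succ_X_mul]; simp

theorem ghost_injective [IsAddTorsionFree A] {f g : BigWitt A} (h : f.ghost = g.ghost) :
    f = g := by
  ext n
  exact coeff_eq_of_powerSum f.constantCoeff_series g.constantCoeff_series f.series_mul_ghost
    g.series_mul_ghost n (fun i _ => by rw [h]) n le_rfl

theorem coeff_traceSeries_companion (f : BigWitt A) (n i : ℕ) (hi : i ≤ n) :
    PowerSeries.coeff i (traceSeries (companion n f.series)) = PowerSeries.coeff i f.ghost := by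
  refine powerSum_eq_of_coeff ?_ f.constantCoeff_series (charpolyRev_mul_traceSeries _)
    f.series_mul_ghost n ?_ i hi
  · rw [← PowerSeries.coeff_zero_eq_constantCoeff_apply, Polynomial.coeff_coe,
      coeff_charpolyRev_companion _ _ f.constantCoeff_series, if_pos (Nat.zero_le n),
      PowerSeries.coeff_zero_eq_constantCoeff_apply, f.constantCoeff_series]
  · intro k hk
    rw [Polynomial.coeff_coe, coeff_charpolyRev_companion _ _ f.constantCoeff_series, if_pos hk]

theorem kronecker_pow {n m : Type*} [Fintype n] [Fintype m] [DecidableEq n] [DecidableEq m]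
    (M : Matrix n n A) (N : Matrix m m A) (i : ℕ) : (M ⊗ₖ N) ^ i = (M ^ i) ⊗ₖ (N ^ i) := by
  induction i with
  | zero => simp
  | succ i ih => rw [pow_succ, pow_succ, pow_succ, ih, Matrix.mul_kronecker_mul]

theorem coeff_traceSeries_kronecker {n m : Type*} [Fintype n] [Fintype m] [DecidableEq n]
    [DecidableEq m] (M : Matrix n n A) (N : Matrix m m A) (i : ℕ) :
    PowerSeries.coeff i (traceSeries (M ⊗ₖ N)) =
      PowerSeries.coeff i (traceSeries M) * PowerSeries.coeff i (traceSeries N) := by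
  simp only [traceSeries, PowerSeries.coeff_mk]
  split_ifs
  · simp
  · rw [kronecker_pow, Matrix.trace_kronecker]

theorem coeff_mul_series_of_le [IsAddTorsionFree A] (f g : BigWitt A) (n k : ℕ) (hk : k ≤ n) :
    PowerSeries.coeff k (f * g).series = (approx n f.series g.series).coeff k := by
  rw [coeff_mul_series, ← Polynomial.coeff_coe, ← Polynomial.coeff_coe]
  refine coeff_eq_of_powerSum (approx_constantCoeff _ _ _) (approx_constantCoeff _ _ _)
    (charpolyRev_mul_traceSeries _) (charpolyRev_mul_traceSeries _) k ?_ k le_rfl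
  intro i hi
  rw [coeff_traceSeries_kronecker, coeff_traceSeries_kronecker,
    coeff_traceSeries_companion f k i hi, coeff_traceSeries_companion g k i hi,
    coeff_traceSeries_companion f n i (hi.trans hk),
    coeff_traceSeries_companion g n i (hi.trans hk)]

theorem coeff_ghost_mul [IsAddTorsionFree A] (f g : BigWitt A) (n : ℕ) :
    PowerSeries.coeff n (f * g).ghost =
      PowerSeries.coeff n f.ghost * PowerSeries.coeff n g.ghost := by
  rw [← coeff_traceSeries_companion f n n le_rfl, ← coeff_traceSeries_companion g n n le_rfl,
    ← coeff_traceSeries_kronecker]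
  refine powerSum_eq_of_coeff (f * g).constantCoeff_series
    (approx_constantCoeff n f.series g.series) (f * g).series_mul_ghost
    (charpolyRev_mul_traceSeries _) n ?_ n le_rfl
  intro i hi
  rw [coeff_mul_series_of_le f g n i hi, Polynomial.coeff_coe]

end Ops

/-! ## The ring structure -/

section Functor

variable {A B : Type*} [CommRing A] [CommRing B]

/-- The map on underlying sets induced by a ring homomorphism. -/
noncomputable def mapFun (φ : A →+* B) (f : BigWitt A) : BigWitt B :=
  ⟨PowerSeries.map φ f.series, by
    rw [← PowerSeries.coeff_zero_eq_constantCoeff_apply, PowerSeries.coeff_map,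
      PowerSeries.coeff_zero_eq_constantCoeff_apply, f.constantCoeff_series, map_one]⟩

theorem mapFun_series (φ : A →+* B) (f : BigWitt A) :
    (mapFun φ f).series = PowerSeries.map φ f.series := rfl

theorem mapFun_add (φ : A →+* B) (f g : BigWitt A) :
    mapFun φ (f + g) = mapFun φ f + mapFun φ g := by
  ext1
  rw [mapFun_series, add_series, map_mul]
  rfl

theorem mapFun_zero (φ : A →+* B) : mapFun φ 0 = 0 := by
  ext1
  rw [mapFun_series, zero_series, zero_series, map_one]

theorem mapFun_one (φ : A →+* B) : mapFun φ 1 = 1 := by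
  ext1
  rw [mapFun_series, one_series, one_series, map_sub, map_one, PowerSeries.map_X]

theorem map_approx (φ : A →+* B) (n : ℕ) (f g : A⟦X⟧) :
    approx n (PowerSeries.map φ f) (PowerSeries.map φ g) = (approx n f g).map φ := by
  rw [approx, approx, ← map_charpolyRev, ← map_companion, ← map_companion]
  congr 1
  ext i j
  simp [Matrix.kroneckerMap_apply]

theorem mapFun_mul (φ : A →+* B) (f g : BigWitt A) :
    mapFun φ (f * g) = mapFun φ f * mapFun φ g := by
  ext n
  rw [mapFun_series, PowerSeries.coeff_map, coeff_mul_series, coeff_mul_series, mapFun_series,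
    mapFun_series, map_approx, Polynomial.coeff_map]

end Functor

section Lift

variable {A : Type*} [CommRing A]

/-- The canonical surjection from a polynomial ring over `ℤ` onto `A`. -/
noncomputable def proj (A : Type*) [CommRing A] : MvPolynomial A ℤ →+* A :=
  MvPolynomial.eval₂Hom (Int.castRingHom A) id

open Classical in
/-- A lift of an element of `A` that preserves `0`. -/
noncomputable def liftElt (a : A) : MvPolynomial A ℤ := if a = 0 then 0 else MvPolynomial.X a

theorem proj_liftElt (a : A) : proj A (liftElt a) = a := by
  unfold liftElt
  split_ifs with h
  · rw [map_zero, h]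
  · simp [proj]

/-- A lift of a big Witt vector to a polynomial ring over `ℤ`. -/
noncomputable def lift (f : BigWitt A) : BigWitt (MvPolynomial A ℤ) :=
  ⟨PowerSeries.mk fun n => if n = 0 then 1 else liftElt (PowerSeries.coeff n f.series), by
    rw [← PowerSeries.coeff_zero_eq_constantCoeff_apply, PowerSeries.coeff_mk, if_pos rfl]⟩

theorem mapFun_lift (f : BigWitt A) : mapFun (proj A) f.lift = f := by
  ext n
  rw [mapFun_series, PowerSeries.coeff_map, lift, PowerSeries.coeff_mk]
  split_ifs with h
  · rw [h, map_one, PowerSeries.coeff_zero_eq_constantCoeff_apply, f.constantCoeff_series]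
  · exact proj_liftElt _

theorem coeff_lift_eq_zero (f : BigWitt A) (n : ℕ) (hn : n ≠ 0)
    (h : PowerSeries.coeff n f.series = 0) : PowerSeries.coeff n f.lift.series = 0 := by
  rw [lift, PowerSeries.coeff_mk, if_neg hn, h, liftElt, if_pos rfl]

theorem mul_comm_aux (f g : BigWitt A) : f * g = g * f := by
  rw [← mapFun_lift f, ← mapFun_lift g, ← mapFun_mul, ← mapFun_mul]
  refine congrArg (mapFun (proj A)) (ghost_injective ?_)
  ext n
  rw [coeff_ghost_mul, coeff_ghost_mul, mul_comm]

theorem mul_assoc_aux (f g h : BigWitt A) : f * g * h = f * (g * h) := by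
  rw [← mapFun_lift f, ← mapFun_lift g, ← mapFun_lift h]
  simp only [← mapFun_mul]
  refine congrArg (mapFun (proj A)) (ghost_injective ?_)
  ext n
  simp only [coeff_ghost_mul, mul_assoc]

theorem one_mul_aux (f : BigWitt A) : 1 * f = f := by
  rw [← mapFun_lift f, ← mapFun_one (proj A), ← mapFun_mul]
  refine congrArg (mapFun (proj A)) (ghost_injective ?_)
  ext n
  rw [coeff_ghost_mul, coeff_ghost_one]
  split_ifs with h
  · rw [h, coeff_ghost_zero, mul_zero]
  · rw [one_mul]

theorem mul_add_aux (f g h : BigWitt A) : f * (g + h) = f * g + f * h := by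
  rw [← mapFun_lift f, ← mapFun_lift g, ← mapFun_lift h]
  simp only [← mapFun_mul, ← mapFun_add]
  refine congrArg (mapFun (proj A)) (ghost_injective ?_)
  ext n
  simp only [coeff_ghost_mul, ghost_add, map_add, mul_add]

theorem zero_mul_aux (f : BigWitt A) : 0 * f = 0 := by
  rw [← mapFun_lift f, ← mapFun_zero (proj A), ← mapFun_mul]
  refine congrArg (mapFun (proj A)) (ghost_injective ?_)
  ext n
  have h0 : (0 : BigWitt (MvPolynomial A ℤ)).ghost = 0 := by
    apply ghost_eq_of_mul_eq
    simp [zero_series]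
  rw [coeff_ghost_mul, h0, map_zero, zero_mul]

/-- The ring `W(A)` of big Witt vectors. -/
noncomputable instance : CommRing (BigWitt A) where
  add_assoc f g h := by ext1; simp only [add_series, mul_assoc]
  zero_add f := by ext1; rw [add_series, zero_series, one_mul]
  add_zero f := by ext1; rw [add_series, zero_series, mul_one]
  add_comm f g := by ext1; rw [add_series, add_series, mul_comm]
  neg_add_cancel f := by ext1; rw [add_series, neg_series, mul_comm, series_mul_inv, zero_series]
  nsmul := nsmulRec
  zsmul := zsmulRec
  mul_assoc := mul_assoc_aux
  mul_comm := mul_comm_aux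
  one_mul := one_mul_aux
  mul_one f := by rw [mul_comm_aux, one_mul_aux]
  zero_mul := zero_mul_aux
  mul_zero f := by rw [mul_comm_aux, zero_mul_aux]
  left_distrib := mul_add_aux
  right_distrib f g h := by
    rw [mul_comm_aux, mul_add_aux, mul_comm_aux h f, mul_comm_aux h g]

/-- The ring homomorphism `W(A) → W(B)` induced by `A → B`. -/
noncomputable def map {B : Type*} [CommRing B] (φ : A →+* B) : BigWitt A →+* BigWitt B where
  toFun := mapFun φ
  map_zero' := mapFun_zero φ
  map_one' := mapFun_one φ
  map_add' := mapFun_add φ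
  map_mul' := mapFun_mul φ

theorem map_series {B : Type*} [CommRing B] (φ : A →+* B) (f : BigWitt A) :
    (map φ f).series = PowerSeries.map φ f.series := rfl

/-- The Teichmüller representative `[a] = 1 - a T`. -/
noncomputable def teichmuller (a : A) : BigWitt A :=
  ⟨1 - PowerSeries.C a * PowerSeries.X, by simp⟩

theorem coeff_ghost_teichmuller (a : A) (n : ℕ) :
    PowerSeries.coeff n (teichmuller a).ghost = if n = 0 then 0 else a ^ n := by
  have h : (teichmuller a).ghost = PowerSeries.rescale a (1 : BigWitt A).ghost := by
    apply ghost_eq_of_mul_eq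
    have h1 := congrArg (PowerSeries.rescale a) (1 : BigWitt A).series_mul_ghost
    rw [map_mul, one_series, map_sub, map_one, PowerSeries.rescale_X, map_neg, map_mul, map_sub,
      Derivation.map_one_eq_zero, PowerSeries.derivative_X, PowerSeries.rescale_X] at h1
    refine h1.trans ?_
    simp [teichmuller, Derivation.leibniz]
    ring
  rw [h, PowerSeries.coeff_rescale, coeff_ghost_one]
  split_ifs with h0 <;> simp

/-- The formula `[b] * f = f(b T)`. Together with biadditivity, functoriality and continuity it
determines the Witt multiplication. -/
theorem teichmuller_mul (b : A) (f : BigWitt A) :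
    (teichmuller b * f).series = PowerSeries.rescale b f.series := by
  have key : ∀ (B : Type _) [CommRing B] [IsAddTorsionFree B] (b : B) (f : BigWitt B),
      (teichmuller b * f).series = PowerSeries.rescale b f.series := by
    intro B _ _ b f
    ext k
    refine coeff_eq_of_powerSum (s := (teichmuller b * f).ghost)
      (t := PowerSeries.rescale b f.ghost) (teichmuller b * f).constantCoeff_series
      ?_ (teichmuller b * f).series_mul_ghost ?_ k ?_ k le_rfl
    · rw [← PowerSeries.coeff_zero_eq_constantCoeff_apply, PowerSeries.coeff_rescale,
        PowerSeries.coeff_zero_eq_constantCoeff_apply, f.constantCoeff_series, pow_zero, one_mul]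
    · rw [← map_mul, f.series_mul_ghost, map_neg]
      congr 1
      ext n
      cases n with
      | zero => simp
      | succ n =>
        rw [PowerSeries.coeff_rescale, PowerSeries.coeff_succ_X_mul, PowerSeries.coeff_succ_X_mul,
          PowerSeries.coeff_derivative, PowerSeries.coeff_derivative, PowerSeries.coeff_rescale]
        ring
    · intro i _
      rw [coeff_ghost_mul, coeff_ghost_teichmuller, PowerSeries.coeff_rescale]
      split_ifs with h
      · rw [h, coeff_ghost_zero, mul_zero, mul_zero]
      · rfl
  have hb : mapFun (proj A) (teichmuller (liftElt b)) = teichmuller b := by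
    ext1
    rw [mapFun_series, teichmuller, teichmuller]
    simp only [map_sub, map_one, map_mul, PowerSeries.map_C, PowerSeries.map_X, proj_liftElt]
  have h := congrArg (PowerSeries.map (proj A)) (key _ (liftElt b) f.lift)
  rw [← mapFun_series, mapFun_mul, hb, mapFun_lift] at h
  rw [h]
  ext n
  rw [PowerSeries.coeff_map, PowerSeries.coeff_rescale, PowerSeries.coeff_rescale, map_mul,
    map_pow, proj_liftElt, ← PowerSeries.coeff_map, ← mapFun_series, mapFun_lift]

/-! ## Rational Witt vectors -/

theorem coeff_mul_series_of_bounded (f g : BigWitt A) (n : ℕ)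
    (hf : ∀ k, n < k → PowerSeries.coeff k f.series = 0)
    (hg : ∀ k, n < k → PowerSeries.coeff k g.series = 0) :
    (f * g).series = (approx n f.series g.series : A⟦X⟧) := by
  have key : ∀ (B : Type _) [CommRing B] [IsAddTorsionFree B] (f g : BigWitt B),
      (∀ k, n < k → PowerSeries.coeff k f.series = 0) →
      (∀ k, n < k → PowerSeries.coeff k g.series = 0) →
      (f * g).series = (approx n f.series g.series : B⟦X⟧) := by
    intro B _ _ f g hf hg
    have hc : ∀ f : BigWitt B, (∀ k, n < k → PowerSeries.coeff k f.series = 0) →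
        traceSeries (companion n f.series) = f.ghost := by
      intro f hf
      symm
      apply ghost_eq_of_mul_eq
      have h1 : f.series = ((companion n f.series).charpolyRev : B⟦X⟧) := by
        ext k
        rw [Polynomial.coeff_coe, coeff_charpolyRev_companion _ _ f.constantCoeff_series]
        split_ifs with h
        · rfl
        · exact hf k (by omega)
      have h2 := charpolyRev_mul_traceSeries (companion n f.series)
      rwa [← h1] at h2
    ext k
    refine coeff_eq_of_powerSum (f * g).constantCoeff_series (approx_constantCoeff _ _ _)
      (f * g).series_mul_ghost (charpolyRev_mul_traceSeries _) k ?_ k le_rfl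
    intro i _
    rw [coeff_ghost_mul, coeff_traceSeries_kronecker, hc f hf, hc g hg]
  have h := key _ f.lift g.lift
    (fun k hk => coeff_lift_eq_zero f k (by omega) (hf k hk))
    (fun k hk => coeff_lift_eq_zero g k (by omega) (hg k hk))
  have h' := congrArg (PowerSeries.map (proj A)) h
  rw [← mapFun_series, mapFun_mul, mapFun_lift, mapFun_lift] at h'
  rw [h', ← Polynomial.polynomial_map_coe, ← map_approx, ← mapFun_series, ← mapFun_series,
    mapFun_lift, mapFun_lift]

/-- `f` is a polynomial. -/
def IsPoly (f : BigWitt A) : Prop := ∃ P : A[X], f.series = (P : A⟦X⟧)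

theorem IsPoly.add {f g : BigWitt A} (hf : f.IsPoly) (hg : g.IsPoly) : (f + g).IsPoly := by
  obtain ⟨P, hP⟩ := hf
  obtain ⟨Q, hQ⟩ := hg
  exact ⟨P * Q, by rw [add_series, hP, hQ, Polynomial.coe_mul]⟩

theorem IsPoly.mul {f g : BigWitt A} (hf : f.IsPoly) (hg : g.IsPoly) : (f * g).IsPoly := by
  obtain ⟨P, hP⟩ := hf
  obtain ⟨Q, hQ⟩ := hg
  refine ⟨_, coeff_mul_series_of_bounded f g (P.natDegree + Q.natDegree) ?_ ?_⟩
  · intro k hk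
    rw [hP, Polynomial.coeff_coe]
    exact Polynomial.coeff_eq_zero_of_natDegree_lt (by omega)
  · intro k hk
    rw [hQ, Polynomial.coeff_coe]
    exact Polynomial.coeff_eq_zero_of_natDegree_lt (by omega)

/-- `f = P / Q` for polynomials `P`, `Q` over `A` with constant term `1`. -/
def IsRational (f : BigWitt A) : Prop :=
  ∃ P Q : A[X], P.coeff 0 = 1 ∧ Q.coeff 0 = 1 ∧ f.series * (Q : A⟦X⟧) = (P : A⟦X⟧)

theorem isRational_iff (f : BigWitt A) :
    f.IsRational ↔ ∃ p q : BigWitt A, p.IsPoly ∧ q.IsPoly ∧ f + q = p := by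
  constructor
  · rintro ⟨P, Q, hP, hQ, h⟩
    exact ⟨⟨P, by simpa using hP⟩, ⟨Q, by simpa using hQ⟩, ⟨P, rfl⟩, ⟨Q, rfl⟩, by ext1; exact h⟩
  · rintro ⟨p, q, ⟨P, hP⟩, ⟨Q, hQ⟩, h⟩
    refine ⟨P, Q, ?_, ?_, ?_⟩
    · have := p.constantCoeff_series
      rw [hP] at this
      simpa using this
    · have := q.constantCoeff_series
      rw [hQ] at this
      simpa using this
    · rw [← hP, ← hQ, ← add_series, h]

end Lift

end BigWitt

open BigWitt in
/-- The subring `W_rat(A)` of `W(A)` of rational Witt vectors. -/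
noncomputable def RationalWitt (A : Type*) [CommRing A] : Subring (BigWitt A) where
  carrier := {f | f.IsRational}
  mul_mem' {f g} hf hg := by
    obtain ⟨p, q, hp, hq, h⟩ := (isRational_iff f).mp hf
    obtain ⟨p', q', hp', hq', h'⟩ := (isRational_iff g).mp hg
    refine (isRational_iff _).mpr
      ⟨p * p' + q * q', p * q' + q * p', (hp.mul hp').add (hq.mul hq'),
        (hp.mul hq').add (hq.mul hp'), ?_⟩
    rw [← h, ← h']
    ring
  one_mem' := (isRational_iff _).mpr
    ⟨1, 0, ⟨1 - Polynomial.X, by simp [one_series]⟩, ⟨1, by simp [zero_series]⟩, add_zero 1⟩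
  add_mem' {f g} hf hg := by
    obtain ⟨p, q, hp, hq, h⟩ := (isRational_iff f).mp hf
    obtain ⟨p', q', hp', hq', h'⟩ := (isRational_iff g).mp hg
    refine (isRational_iff _).mpr ⟨p + p', q + q', hp.add hp', hq.add hq', ?_⟩
    rw [← h, ← h']
    ring
  zero_mem' := (isRational_iff _).mpr
    ⟨0, 0, ⟨1, by simp [zero_series]⟩, ⟨1, by simp [zero_series]⟩, add_zero 0⟩
  neg_mem' {f} hf := by
    obtain ⟨p, q, hp, hq, h⟩ := (isRational_iff f).mp hf
    refine (isRational_iff _).mpr ⟨q, p, hq, hp, ?_⟩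
    rw [← h]
    ring

namespace RationalWitt

theorem map_mem {A B : Type*} [CommRing A] [CommRing B] (φ : A →+* B) (f : BigWitt A)
    (hf : f ∈ RationalWitt A) : BigWitt.map φ f ∈ RationalWitt B := by
  obtain ⟨P, Q, hP, hQ, h⟩ := hf
  refine ⟨P.map φ, Q.map φ, by simp [hP], by simp [hQ], ?_⟩
  rw [BigWitt.map_series, Polynomial.polynomial_map_coe, Polynomial.polynomial_map_coe, ← map_mul,
    h]

/-- The ring homomorphism `W_rat(A) → W_rat(B)` induced by `A → B`. -/
noncomputable def map {A B : Type*} [CommRing A] [CommRing B] (φ : A →+* B) :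
    RationalWitt A →+* RationalWitt B :=
  (BigWitt.map φ).restrict (RationalWitt A) (RationalWitt B) (map_mem φ)

/-- The functor `W_rat` from commutative rings to commutative rings. -/
noncomputable def functor : CommRingCat ⥤ CommRingCat where
  obj A := CommRingCat.of (RationalWitt A)
  map φ := CommRingCat.ofHom (map φ.hom)
  map_id A := by
    ext f : 2
    apply Subtype.ext
    ext n
    rfl
  map_comp φ ψ := by
    ext f : 2
    apply Subtype.ext
    ext n
    rfl

end RationalWitt

/-! ## Hankel matrices -/

namespace BigWitt

variable {A : Type*} [CommRing A]

/-- The infinite Hankel matrix `H(f) = (a_{i+j})` of `f = ∑ aᵢ Tⁱ`. -/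
noncomputable def hankel (f : BigWitt A) : Matrix ℕ ℕ A :=
  fun i j => PowerSeries.coeff (i + j) f.series

/-- `rk H(f) ≤ r`: all minors of size `r + 1` of the Hankel matrix vanish. -/
def HankelRankLE (r : ℕ) (f : BigWitt A) : Prop :=
  ∀ i j : Fin (r + 1) → ℕ, StrictMono i → StrictMono j → (f.hankel.submatrix i j).det = 0

end BigWitt

/-- The subset `W_J(A)` of `W(A)` of all `f` whose Hankel matrix has finite rank. -/
def HankelWitt (A : Type*) [CommRing A] : Set (BigWitt A) :=
  {f | ∃ r : ℕ, 1 ≤ r ∧ f.HankelRankLE r}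

/-! ## Strong Fatou domains and schemes -/

/-- An integral domain `A` with quotient field `K` is a strong Fatou domain if for every power
series `f` over `A` which is a rational function over `K`, the representation `f = P / Q` with
`P`, `Q` coprime in `K[T]` and `Q(0) = 1` satisfies `P, Q ∈ A[T]`. -/
def IsStrongFatouDomain (A : Type*) [CommRing A] : Prop :=
  IsDomain A ∧ ∀ (f : A⟦X⟧) (P Q : (FractionRing A)[X]), IsCoprime P Q → Q.coeff 0 = 1 →
    PowerSeries.map (algebraMap A (FractionRing A)) f * (Q : (FractionRing A)⟦X⟧) =
      (P : (FractionRing A)⟦X⟧) →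
    P ∈ Polynomial.lifts (algebraMap A (FractionRing A)) ∧
      Q ∈ Polynomial.lifts (algebraMap A (FractionRing A))

/-- An integral scheme is strong Fatou if the coordinate rings of all its nonempty affine open
subschemes are strong Fatou domains. -/
def IsStrongFatouScheme (X : AlgebraicGeometry.Scheme) : Prop :=
  AlgebraicGeometry.IsIntegral X ∧ ∀ U : X.Opens, AlgebraicGeometry.IsAffineOpen U →
    (U : Set X).Nonempty → IsStrongFatouDomain Γ(X, U)

/-! For nonempty open U in the integral scheme X, sections over U embed in the function field K, and
rationality of a big Witt vector over Γ(X, U) can be tested over K. A fraction over K reduces to a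
coprime pair P, Q with Q(0) = 1, and this one pair serves all open subsets of U at once. The strong
Fatou property puts its coefficients into Γ(X, V) for every nonempty affine V inside U. An element
of K that is regular on all these V is regular on U, so the fraction is defined over Γ(X, U) even
when U is not affine. This is `isRational_of_functionField`.

Both assertions follow from this descent. Vanishing of Hankel minors passes from Γ(X, U) to K, where
Kronecker's criterion `HankelRankLE.exists_mul_eq` turns it into rationality; the converse
`IsRational.exists_hankelRankLE` is a linear recurrence and holds over every ring. For the sheaf
property, big Witt vectors glue coefficient by coefficient, and a glued vector is rational over K
because its restriction to a single nonempty member of the cover already is. -/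

namespace BigWitt

/-! ### Rational series have finite Hankel rank, over any commutative ring. -/

section Hankel

variable {A : Type*} [CommRing A]

/-- The matrix factors through `A ^ d`. Padding the factors with a zero column and a zero row makes
them square, so multiplicativity of the determinant replaces a rank argument, which would need a
field. -/
theorem det_eq_zero_of_forall_mem_span {d : ℕ} (M : Matrix (Fin (d + 1)) (Fin (d + 1)) A)
    (v : Fin d → Fin (d + 1) → A) (h : ∀ i, M i ∈ Submodule.span A (Set.range v)) :
    M.det = 0 := by
  choose c hc using fun i => (Submodule.mem_span_range_iff_exists_fun A).mp (h i)
  have hM : M = Matrix.of (fun i => Fin.snoc (α := fun _ => A) (c i) 0) *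
      Matrix.of (fun k j => Fin.snoc (α := fun _ => A) (fun l => v l j) 0 k) := by
    ext i j
    rw [← hc i, Matrix.mul_apply, Fin.sum_univ_castSucc]
    simp
  rw [hM, Matrix.det_mul, Matrix.det_eq_zero_of_column_eq_zero (Fin.last d), zero_mul]
  simp

/-- A rational power series has a Hankel matrix of finite rank. -/
theorem IsRational.exists_hankelRankLE {f : BigWitt A} (hf : f.IsRational) :
    ∃ r : ℕ, 1 ≤ r ∧ f.HankelRankLE r := by
  obtain ⟨P, Q, -, hQ, h⟩ := hf
  -- From row `d` on, the coefficients of `P` no longer contribute and all shifts by at most `deg Q`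
  -- stay in range; the `+ 1` also gives `1 ≤ d`.
  set d := P.natDegree + Q.natDegree + 1 with hd
  refine ⟨d, by omega, fun i j _ _ => ?_⟩
  have hrow : ∀ n, f.hankel n ∈ Submodule.span A (Set.range fun k : Fin d => f.hankel k) := by
    intro n
    induction n using Nat.strong_induction_on with
    | _ n ih =>
      by_cases hn : n < d
      · exact Submodule.subset_span ⟨⟨n, hn⟩, rfl⟩
      -- Comparing coefficients of degree `n + m` in `f Q = P`, with `Q(0) = 1`, gives a recurrence
      -- whose shift falls entirely on the row index, since `deg Q ≤ n`. It therefore relates whole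
      -- rows.
      have hrec : f.hankel n = -∑ k ∈ Finset.range Q.natDegree,
          Q.coeff (k + 1) • f.hankel (n - (k + 1)) := by
        ext m
        have e := congrArg (PowerSeries.coeff (n + m)) h
        rw [mul_comm, PowerSeries.coeff_mul, Finset.Nat.sum_antidiagonal_eq_sum_range_succ_mk,
          Polynomial.coeff_coe, Polynomial.coeff_eq_zero_of_natDegree_lt (p := P) (by omega),
          ← Finset.sum_subset (Finset.range_subset_range.mpr
            (show Q.natDegree + 1 ≤ (n + m).succ by omega)),
          Finset.sum_range_succ'] at e
        · simp only [Polynomial.coeff_coe, hQ, one_mul, Nat.sub_zero] at e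
          rw [Pi.neg_apply, Finset.sum_apply, eq_neg_iff_add_eq_zero, add_comm, ← e]
          congr 1
          refine Finset.sum_congr rfl fun k hk => ?_
          have := Finset.mem_range.mp hk
          rw [Pi.smul_apply, smul_eq_mul, hankel,
            show n - (k + 1) + m = n + m - (k + 1) by omega]
        · intro k _ hk
          rw [Finset.mem_range] at hk
          rw [Polynomial.coeff_coe, Polynomial.coeff_eq_zero_of_natDegree_lt (by omega), zero_mul]
      rw [hrec]
      exact Submodule.neg_mem _ (Submodule.sum_mem _ fun k _ =>
        Submodule.smul_mem _ _ (ih _ (by omega)))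
  refine det_eq_zero_of_forall_mem_span _ (fun k l => f.hankel k (j l)) fun l => ?_
  -- Selecting the columns `j` is a linear map, so it carries the span relation to the rows of the
  -- minor.
  have h1 := Submodule.mem_map_of_mem (f := LinearMap.funLeft A A j) (hrow (i l))
  rw [Submodule.map_span, ← Set.range_comp] at h1
  exact h1

theorem HankelRankLE.map {B : Type*} [CommRing B] (φ : A →+* B) {r : ℕ} {f : BigWitt A}
    (h : f.HankelRankLE r) : (BigWitt.map φ f).HankelRankLE r := by
  intro i j hi hj
  have h1 := congrArg φ (h i j hi hj)
  rw [RingHom.map_det, map_zero] at h1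
  rw [← h1]
  congr 1

end Hankel

/-! ### Kronecker's criterion and reduced fractions over a field. -/

section Field

variable {K : Type*} [Field K]

/-- If all `n × n` minors, with increasing columns, of a matrix with `n` rows over a field vanish,
then its rows are linearly dependent. -/
theorem exists_dotProduct_eq_zero_of_det_eq_zero {n : ℕ} (M : Matrix (Fin n) ℕ K)
    (h : ∀ j : Fin n → ℕ, StrictMono j → (M.submatrix id j).det = 0) :
    ∃ c : Fin n → K, c ≠ 0 ∧ ∀ k, ∑ i, c i * M i k = 0 := by
  -- If the columns span, then `n` of them form a basis and give a nonzero minor; otherwise a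
  -- nonzero functional kills all columns and its coordinates are the required relation.
  by_cases hs : Submodule.span K (Set.range M.col) = ⊤
  · exfalso
    obtain ⟨b, hb, -, hli⟩ := Submodule.exists_fun_fin_finrank_span_eq K (Set.range M.col)
    have hn : Module.finrank K (Submodule.span K (Set.range M.col)) = n := by
      rw [hs, finrank_top, Module.finrank_fin_fun]
    choose g hg using hb
    have hginj : Function.Injective g := fun x y hxy =>
      hli.injective (by rw [← hg x, ← hg y, hxy])
    set s := Finset.univ.image g with hs'
    -- The basis columns come in no particular order, while `h` concerns increasing indices. Hence
    -- their index set is enumerated increasingly, with `t` as the reindexing of the basis.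
    have hcard : s.card = n := by
      rw [hs', Finset.card_image_of_injective _ hginj, Finset.card_univ, Fintype.card_fin, hn]
    have hmem : ∀ a : Fin n, ∃ x, g x = s.orderEmbOfFin hcard a := fun a => by
      obtain ⟨x, -, hx⟩ := Finset.mem_image.mp (s.orderEmbOfFin_mem hcard a)
      exact ⟨x, hx⟩
    choose t ht using hmem
    have htinj : Function.Injective t := fun x y hxy =>
      (s.orderEmbOfFin hcard).injective (by rw [← ht x, ← ht y, hxy])
    have hli' : LinearIndependent K (M.submatrix id (s.orderEmbOfFin hcard)).col := by
      have hcol : (M.submatrix id (s.orderEmbOfFin hcard)).col = b ∘ t := by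
        ext a i
        simp [← hg, ht]
      rw [hcol]
      exact hli.comp t htinj
    have hu := Matrix.linearIndependent_cols_iff_isUnit.mp hli'
    rw [Matrix.isUnit_iff_isUnit_det, h _ (s.orderEmbOfFin hcard).strictMono] at hu
    exact not_isUnit_zero hu
  · obtain ⟨φ, hφ, hker⟩ := Submodule.exists_le_ker_of_lt_top _ (lt_top_iff_ne_top.mpr hs)
    have hφ' : ∀ v, φ v = ∑ i, φ (Pi.single i 1) * v i := fun v => by
      conv_lhs => rw [← Finset.univ_sum_single v, map_sum]
      refine Finset.sum_congr rfl fun i _ => ?_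
      rw [← mul_one (v i), ← smul_eq_mul, Pi.single_smul, map_smul, smul_eq_mul, smul_eq_mul,
        mul_one, mul_comm]
    refine ⟨fun i => φ (Pi.single i 1), fun h0 => hφ ?_, fun k => ?_⟩
    · ext v
      simpa using congrFun h0 v
    · exact (hφ' _).symm.trans (hker (Submodule.subset_span ⟨k, rfl⟩))

/-- Kronecker's criterion: a power series over a field whose Hankel matrix has finite rank is a
rational function. -/
theorem HankelRankLE.exists_mul_eq {r : ℕ} {f : BigWitt K} (h : f.HankelRankLE r) :
    ∃ P Q : K[X], Q ≠ 0 ∧ f.series * (Q : K⟦X⟧) = (P : K⟦X⟧) := by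
  -- A relation among the first `r + 1` rows says that `∑ cᵢ a_{i+k} = 0` for every `k`, a linear
  -- recurrence for the coefficients of `f`.
  obtain ⟨c, hc, hsum⟩ := exists_dotProduct_eq_zero_of_det_eq_zero
    (f.hankel.submatrix (fun i : Fin (r + 1) => (i : ℕ)) id)
    (fun j hj => h _ j Fin.val_strictMono hj)
  -- The exponents are reversed so that, for `n ≥ r`, the coefficient of degree `n` in `f Q` is the
  -- relation at `k = n - r`. Thus `f Q` has no terms of degree `≥ r` and equals its truncation.
  set Q : K[X] := ∑ i : Fin (r + 1), Polynomial.C (c i) * Polynomial.X ^ (r - (i : ℕ)) with hQ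
  have hcoeff : ∀ i : Fin (r + 1), Q.coeff (r - (i : ℕ)) = c i := fun i => by
    rw [hQ, Polynomial.finsetSum_coeff, Finset.sum_eq_single i]
    · simp
    · intro k _ hk
      rw [Polynomial.coeff_C_mul_X_pow, if_neg]
      intro h1
      apply hk
      ext
      have := k.2
      have := i.2
      omega
    · simp
  refine ⟨(f.series * (Q : K⟦X⟧)).trunc r, Q, fun h0 => hc ?_, ?_⟩
  · ext i
    rw [← hcoeff, h0]
    simp
  · ext n
    rw [Polynomial.coeff_coe, PowerSeries.coeff_trunc]
    split_ifs with hn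
    · rfl
    have h1 : (Q : K⟦X⟧) = ∑ i : Fin (r + 1),
        PowerSeries.C (c i) * PowerSeries.X ^ (r - (i : ℕ)) := by
      rw [hQ, ← Polynomial.coeToPowerSeries.ringHom_apply, map_sum]
      simp
    rw [h1, Finset.mul_sum, map_sum, ← hsum (n - r)]
    refine Finset.sum_congr rfl fun i _ => ?_
    have := i.2
    rw [mul_left_comm, PowerSeries.coeff_C_mul, PowerSeries.coeff_mul_X_pow', if_pos (by omega)]
    simp only [Matrix.submatrix_apply, id, hankel]
    congr 3
    omega

/-- A power series over a field which is a rational function is a quotient `P / Q` of coprime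
polynomials with `Q(0) = 1`. -/
theorem exists_isCoprime_mul_eq {f : K⟦X⟧} {P Q : K[X]} (hQ : Q ≠ 0)
    (h : f * (Q : K⟦X⟧) = (P : K⟦X⟧)) :
    ∃ P' Q' : K[X], IsCoprime P' Q' ∧ Q'.coeff 0 = 1 ∧ f * (Q' : K⟦X⟧) = (P' : K⟦X⟧) := by
  classical
  obtain ⟨p, hp⟩ := EuclideanDomain.gcd_dvd_left P Q
  obtain ⟨q, hq⟩ := EuclideanDomain.gcd_dvd_right P Q
  set g := EuclideanDomain.gcd P Q with hg
  have hg0 : g ≠ 0 := fun h0 => hQ (by rw [hq, h0, zero_mul])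
  have hcop : IsCoprime p q := by
    refine ⟨EuclideanDomain.gcdA P Q, EuclideanDomain.gcdB P Q, mul_left_cancel₀ hg0 ?_⟩
    linear_combination -(EuclideanDomain.gcd_eq_gcd_ab P Q) - EuclideanDomain.gcdA P Q * hp -
      EuclideanDomain.gcdB P Q * hq
  have hpq : f * (q : K⟦X⟧) = (p : K⟦X⟧) := by
    have hg' : (g : K⟦X⟧) ≠ 0 := by simpa using hg0
    apply mul_left_cancel₀ hg'
    rw [← Polynomial.coe_mul, ← hp, ← h, mul_left_comm, ← Polynomial.coe_mul, ← hq]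
  -- A power series has no pole at 0: if `q(0) = 0`, then `p(0) = f(0) q(0) = 0`, and `T` would
  -- divide both coprime polynomials.
  have hq0 : q.coeff 0 ≠ 0 := by
    intro h0
    have hp0 : p.coeff 0 = 0 := by
      have := congrArg PowerSeries.constantCoeff hpq
      rw [map_mul, Polynomial.constantCoeff_coe, Polynomial.constantCoeff_coe, h0, mul_zero] at this
      exact this.symm
    exact Polynomial.not_isUnit_X (hcop.isUnit_of_dvd' (Polynomial.X_dvd_iff.mpr hp0)
      (Polynomial.X_dvd_iff.mpr h0))
  have hu : IsUnit (Polynomial.C (q.coeff 0)⁻¹) :=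
    Polynomial.isUnit_C.mpr (inv_ne_zero hq0).isUnit
  refine ⟨Polynomial.C (q.coeff 0)⁻¹ * p, Polynomial.C (q.coeff 0)⁻¹ * q, ?_, ?_, ?_⟩
  · exact (isCoprime_mul_unit_left hu p q).mpr hcop
  · rw [Polynomial.coeff_C_mul, inv_mul_cancel₀ hq0]
  · rw [Polynomial.coe_mul, Polynomial.coe_mul, ← hpq]
    ring

end Field

end BigWitt

/-! ### Descent from the function field on a strong Fatou scheme. -/

/-- The definition refers to `FractionRing A`, whereas the descent needs one field common to all
affine opens, namely the function field. The isomorphism of fraction fields over `A` transports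
coprimality, the equation and the coefficients. -/
theorem IsStrongFatouDomain.mem_lifts {A : Type*} [CommRing A] (hA : IsStrongFatouDomain A)
    (K : Type*) [Field K] [Algebra A K] [IsFractionRing A K] {f : A⟦X⟧} {P Q : K[X]}
    (hPQ : IsCoprime P Q) (hQ : Q.coeff 0 = 1)
    (h : PowerSeries.map (algebraMap A K) f * (Q : K⟦X⟧) = (P : K⟦X⟧)) :
    P ∈ Polynomial.lifts (algebraMap A K) ∧ Q ∈ Polynomial.lifts (algebraMap A K) := by
  let e := (FractionRing.algEquiv A K).symm
  let φ : K →+* FractionRing A := (e : K →+* FractionRing A)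
  have hφ : φ.comp (algebraMap A K) = algebraMap A (FractionRing A) := RingHom.ext e.commutes
  have hlift : ∀ R : K[X], R.map φ ∈ Polynomial.lifts (algebraMap A (FractionRing A)) →
      R ∈ Polynomial.lifts (algebraMap A K) := by
    intro R hR
    rw [Polynomial.lifts_iff_coeff_lifts] at hR ⊢
    intro n
    obtain ⟨a, ha⟩ := hR n
    refine ⟨a, e.injective ?_⟩
    rw [e.commutes, ha, Polynomial.coeff_map]
    rfl
  have key := hA.2 f (P.map φ) (Q.map φ) (hPQ.map (Polynomial.mapRingHom φ)) (by simp [hQ]) (by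
    rw [Polynomial.polynomial_map_coe, Polynomial.polynomial_map_coe, ← h, map_mul,
      ← RingHom.comp_apply (PowerSeries.map φ), ← PowerSeries.map_comp, hφ])
  exact ⟨hlift P key.1, hlift Q key.2⟩

namespace BigWitt

variable {X : AlgebraicGeometry.Scheme}

theorem algebraMap_functionField_restrict [AlgebraicGeometry.IsIntegral X] {V U : X.Opens}
    [Nonempty V] [Nonempty U] (i : V ⟶ U) (a : Γ(X, U)) :
    algebraMap Γ(X, V) X.functionField (X.presheaf.map i.op a) =
      algebraMap Γ(X, U) X.functionField a :=
  TopCat.Presheaf.germ_res_apply X.presheaf i _ _ a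

/-- On an integral scheme, a rational function which is regular on all nonempty affine open
subsets of `U` is regular on `U`. -/
theorem mem_range_algebraMap_functionField [AlgebraicGeometry.IsIntegral X] (U : X.Opens)
    [Nonempty U] (x : X.functionField)
    (h : ∀ (V : X.Opens) [Nonempty V], AlgebraicGeometry.IsAffineOpen V → V ≤ U →
      x ∈ Set.range (algebraMap Γ(X, V) X.functionField)) :
    x ∈ Set.range (algebraMap Γ(X, U) X.functionField) := by
  -- The empty open is left out because its sections do not map to the function field.
  let ι := {V : X.Opens // AlgebraicGeometry.IsAffineOpen V ∧ V ≤ U ∧ Nonempty V}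
  have hne : ∀ V : ι, Nonempty V.1 := fun V => V.2.2.2
  choose s hs using fun V : ι => h V.1 V.2.1 V.2.2.1
  have hcover : U ≤ iSup (fun V : ι => V.1) := by
    intro y hy
    obtain ⟨V, hV, hyV, hVU⟩ := TopologicalSpace.Opens.isBasis_iff_nbhd.mp
      X.isBasis_affineOpens hy
    exact TopologicalSpace.Opens.mem_iSup.mpr ⟨⟨V, hV, hVU, ⟨⟨y, hyV⟩⟩⟩, hyV⟩
  obtain ⟨t, ht, -⟩ := X.sheaf.existsUnique_gluing' (fun V : ι => V.1) U
    (fun V => homOfLE V.2.2.1) hcover s (by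
      intro V W
      -- By irreducibility the overlap is nonempty, so its sections embed in the function field,
      -- where both local sections have image `x`.
      have hVW : Nonempty ((V.1 ⊓ W.1 : X.Opens)) := by
        obtain ⟨⟨v, hv⟩⟩ := hne V
        obtain ⟨⟨w, hw⟩⟩ := hne W
        obtain ⟨z, hz⟩ := nonempty_preirreducible_inter V.1.isOpen W.1.isOpen ⟨v, hv⟩ ⟨w, hw⟩
        exact ⟨⟨z, hz⟩⟩
      apply AlgebraicGeometry.Scheme.germToFunctionField_injective X (V.1 ⊓ W.1)
      exact (algebraMap_functionField_restrict (TopologicalSpace.Opens.infLELeft V.1 W.1) _).trans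
        (((hs V).trans (hs W).symm).trans
        (algebraMap_functionField_restrict (TopologicalSpace.Opens.infLERight V.1 W.1) _).symm))
  obtain ⟨⟨y, hy⟩⟩ := ‹Nonempty U›
  obtain ⟨V, hV⟩ := TopologicalSpace.Opens.mem_iSup.mp (hcover hy)
  refine ⟨t, ?_⟩
  rw [← hs V, ← ht V]
  exact (algebraMap_functionField_restrict _ _).symm

/-- On a strong Fatou scheme, a big Witt vector over the ring of sections is rational as soon as it
is a rational function over the function field. -/
theorem isRational_of_functionField (hX : IsStrongFatouScheme X) [AlgebraicGeometry.IsIntegral X]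
    (U : X.Opens) [Nonempty U] (f : BigWitt Γ(X, U)) (P Q : X.functionField[X]) (hQ : Q ≠ 0)
    (h : (map (algebraMap Γ(X, U) X.functionField) f).series * (Q : X.functionField⟦X⟧) =
      (P : X.functionField⟦X⟧)) :
    f.IsRational := by
  -- The reduced pair is fixed over the function field before any `V` is chosen, so its coefficients
  -- can be glued over all `V`.
  obtain ⟨P, Q, hPQ, hQ, h⟩ := exists_isCoprime_mul_eq hQ h
  have key : ∀ (V : X.Opens) [Nonempty V], AlgebraicGeometry.IsAffineOpen V → V ≤ U →
      P ∈ Polynomial.lifts (algebraMap Γ(X, V) X.functionField) ∧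
        Q ∈ Polynomial.lifts (algebraMap Γ(X, V) X.functionField) := by
    intro V hVne hV hVU
    have hfrac := AlgebraicGeometry.functionField_isFractionRing_of_isAffineOpen X V hV
    refine (hX.2 V hV (Set.nonempty_coe_sort.mp hVne)).mem_lifts X.functionField
      (f := PowerSeries.map (X.presheaf.map (homOfLE hVU).op).hom f.series) hPQ hQ ?_
    rw [← h, map_series]
    congr 1
    ext n
    rw [PowerSeries.coeff_map, PowerSeries.coeff_map, PowerSeries.coeff_map]
    exact algebraMap_functionField_restrict _ _
  have hP' : P ∈ Polynomial.lifts (algebraMap Γ(X, U) X.functionField) :=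
    (Polynomial.lifts_iff_coeff_lifts _).mpr fun n =>
      mem_range_algebraMap_functionField U _ fun V _ hV hVU =>
        (Polynomial.lifts_iff_coeff_lifts _).mp (key V hV hVU).1 n
  have hQ' : Q ∈ Polynomial.lifts (algebraMap Γ(X, U) X.functionField) :=
    (Polynomial.lifts_iff_coeff_lifts _).mpr fun n =>
      mem_range_algebraMap_functionField U _ fun V _ hV hVU =>
        (Polynomial.lifts_iff_coeff_lifts _).mp (key V hV hVU).2 n
  obtain ⟨p, rfl⟩ := (Polynomial.mem_lifts _).mp hP'
  obtain ⟨q, rfl⟩ := (Polynomial.mem_lifts _).mp hQ'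
  have hinj : Function.Injective (algebraMap Γ(X, U) X.functionField) :=
    AlgebraicGeometry.Scheme.germToFunctionField_injective X U
  have hfq : f.series * (q : Γ(X, U)⟦X⟧) = (p : Γ(X, U)⟦X⟧) := by
    apply PowerSeries.map_injective _ hinj
    rw [map_mul, ← Polynomial.polynomial_map_coe, ← Polynomial.polynomial_map_coe]
    exact h
  have hq0 : q.coeff 0 = 1 := hinj (by rw [← Polynomial.coeff_map, hQ, map_one])
  -- The missing condition `p(0) = 1` follows from `f(0) = q(0) = 1`.
  refine ⟨p, q, ?_, hq0, hfq⟩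
  have h0 := congrArg PowerSeries.constantCoeff hfq
  rw [map_mul, f.constantCoeff_series, Polynomial.constantCoeff_coe,
    Polynomial.constantCoeff_coe, hq0, mul_one] at h0
  exact h0.symm

/-- This covers the empty open, whose ring of sections is zero and where no comparison with the
function field is possible. -/
theorem IsRational.of_subsingleton {A : Type*} [CommRing A] [Subsingleton A] (f : BigWitt A) :
    f.IsRational :=
  ⟨1, 1, Subsingleton.elim _ _, Subsingleton.elim _ _, by ext; exact Subsingleton.elim _ _⟩

theorem subsingleton_sections_of_isEmpty (U : X.Opens) (hU : ¬ Nonempty U) :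
    Subsingleton Γ(X, U) := by
  have : U = ⊥ := by
    ext y
    simpa using fun hy => hU ⟨⟨y, hy⟩⟩
  subst this
  infer_instance

theorem isRational_iff_mem_hankelWitt (hX : IsStrongFatouScheme X) (U : X.Opens)
    (f : BigWitt Γ(X, U)) : f.IsRational ↔ f ∈ HankelWitt Γ(X, U) := by
  refine ⟨IsRational.exists_hankelRankLE, fun ⟨r, _, hr⟩ => ?_⟩
  have := hX.1
  by_cases hU : Nonempty U
  · obtain ⟨P, Q, hQ, h⟩ := (hr.map (algebraMap Γ(X, U) X.functionField)).exists_mul_eq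
    exact isRational_of_functionField hX U f P Q hQ h
  · have := subsingleton_sections_of_isEmpty U hU
    exact IsRational.of_subsingleton f

/-! ### Gluing of big Witt vectors and locality of rationality. -/

/-- Big Witt vectors glue: `W` is a sheaf. -/
theorem existsUnique_gluing {ι : Type*} (U : ι → X.Opens) (f : ∀ i, BigWitt Γ(X, U i))
    (h : ∀ i j, map (X.presheaf.map (TopologicalSpace.Opens.infLELeft (U i) (U j)).op).hom (f i) =
      map (X.presheaf.map (TopologicalSpace.Opens.infLERight (U i) (U j)).op).hom (f j)) :
    ∃! g : BigWitt Γ(X, iSup U),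
      ∀ i, map (X.presheaf.map (TopologicalSpace.Opens.leSupr U i).op).hom g = f i := by
  -- Restriction acts on each coefficient separately, so the sheaf axiom of the structure sheaf
  -- applies in each degree.
  have hex : ∀ n, ∃! a : Γ(X, iSup U), ∀ i,
      X.presheaf.map (TopologicalSpace.Opens.leSupr U i).op a =
        PowerSeries.coeff n (f i).series :=
    fun n => X.sheaf.existsUnique_gluing U (fun i => PowerSeries.coeff n (f i).series)
      (fun i j => congrArg (fun g => PowerSeries.coeff n g.series) (h i j))
  choose a ha hau using hex
  -- The section 1 also restricts to all the constant terms, so uniqueness of gluing identifies it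
  -- with `a 0`.
  have ha0 : a 0 = 1 := by
    symm
    apply hau 0
    intro i
    rw [map_one, PowerSeries.coeff_zero_eq_constantCoeff_apply, (f i).constantCoeff_series]
  refine ⟨⟨PowerSeries.mk a, ?_⟩, fun i => ?_, fun g hg => ?_⟩
  · rw [← PowerSeries.coeff_zero_eq_constantCoeff_apply, PowerSeries.coeff_mk, ha0]
  · ext n
    rw [map_series, PowerSeries.coeff_map, PowerSeries.coeff_mk]
    exact ha n i
  · ext n
    rw [PowerSeries.coeff_mk]
    apply hau n
    intro i
    rw [← hg i, map_series, PowerSeries.coeff_map]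

/-- On a strong Fatou scheme, being rational is a local property. -/
theorem isRational_of_locally (hX : IsStrongFatouScheme X) {ι : Type*} (U : ι → X.Opens)
    (g : BigWitt Γ(X, iSup U))
    (h : ∀ i, (map (X.presheaf.map (TopologicalSpace.Opens.leSupr U i).op).hom g).IsRational) :
    g.IsRational := by
  have := hX.1
  by_cases hU : Nonempty (iSup U : X.Opens)
  · obtain ⟨⟨y, hy⟩⟩ := id hU
    obtain ⟨i, hi⟩ := TopologicalSpace.Opens.mem_iSup.mp hy
    have hne : Nonempty (U i) := ⟨⟨y, hi⟩⟩
    -- One nonempty member of the cover suffices: its fraction is already a fraction for `g` over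
    -- the function field.
    obtain ⟨P, Q, -, hQ, hPQ⟩ := h i
    let φ := algebraMap Γ(X, U i) X.functionField
    refine isRational_of_functionField hX _ g (P.map φ) (Q.map φ) (fun h0 => ?_) ?_
    · have := congrArg (fun R => Polynomial.coeff R 0) h0
      simp [hQ] at this
    · rw [Polynomial.polynomial_map_coe, Polynomial.polynomial_map_coe, ← hPQ, map_mul]
      congr 1
      ext n
      simp only [map_series, PowerSeries.coeff_map]
      exact (algebraMap_functionField_restrict _ _).symm
  · have := subsingleton_sections_of_isEmpty _ hU
    exact IsRational.of_subsingleton g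

end BigWitt

theorem theoremt3p3 (X : AlgebraicGeometry.Scheme) (hX : IsStrongFatouScheme X) :
    TopCat.Presheaf.IsSheaf (X.presheaf ⋙ RationalWitt.functor) ∧
      ∀ U : X.Opens, (RationalWitt Γ(X, U) : Set (BigWitt Γ(X, U))) = HankelWitt Γ(X, U) := by
  refine ⟨?_, fun U => Set.ext fun f => BigWitt.isRational_iff_mem_hankelWitt hX U f⟩
  -- Compatible rational Witt vectors glue uniquely as big Witt vectors, so only the rationality of
  -- the result remains.
  rw [TopCat.Presheaf.isSheaf_iff_isSheafUniqueGluing]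
  intro ι U f hf
  obtain ⟨g, hg, hgu⟩ := BigWitt.existsUnique_gluing U (fun i => (f i).1)
    (fun i j => congrArg Subtype.val (hf i j))
  have hgr : g.IsRational := BigWitt.isRational_of_locally hX U g fun i => by
    rw [hg i]
    exact (f i).2
  exact ⟨⟨g, hgr⟩, fun i => Subtype.ext (hg i),
    fun s hs => Subtype.ext (hgu s.1 fun i => congrArg Subtype.val (hs i))⟩
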